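/- Let $X$ be a Tychonoff (completely regular $T_1$) space and let $C(X)$ be the vector lattice of all continuous real-valued functions on $X$, with pointwise order. For $x\in X$ let $\delta_x : C(X)\to\mathbb{R}$, $\delta_x(f)=f(x)$. Let $C(X)^\sim$ be the order dual of $C(X)$, i.e. the space of all linear functionals $\varphi : C(X)\to\mathbb{R}$ that are bounded on every order interval $[a,b]\subseteq C(X)$, and let $C(X)^\sim_c$ be the $\sigma$-order continuous dual, i.e. the space of all $\varphi\in C(X)^\sim$ such that $\varphi(u_n)\to 0$ whenever the sequence $(u_n)$ converges in order to $0$ (that is, $|u_n|\le y_n$ for all $n$ and some sequence $y_n\downarrow 0$ in $C(X)$). Let $c_{00}(X)$ be the space of finitely supported functions $a : X\to\mathbb{R}$. Assume that $X$ is a P-space, i.e. every intersection of countably many open subsets of $X$ is open. Then: (1) $\delta_x\in C(X)^\sim_c$ for every $x\in X$. (2) If, in addition, $X$ is realcompact (that is, for every Tychonoff space $Y$ containing $X$ as a proper dense subspace, the restriction map $C(Y)\to C(X)$, $f\mapsto f|_X$, is not onto), then $$C(X)^\sim=\operatorname{span}\{\delta_x : x\in X\}=c_{00}(X)=C(X)^\sim_c,$$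 where $c_{00}(X)$ is identified with a space of functionals through the map $a\mapsto\sum_{x\in X}a(x)\,\delta_x$. This map is linear, injective, has range $\operatorname{span}\{\delta_x : x\in X\}$, and satisfies $a\le b$ pointwise if and only if $\sum_x a(x) f(x)\le\sum_x b(x) f(x)$ for all $0\le f\in C(X)$. -/

import Mathlib

universe u

/-- A P-space: the intersection of countably many open sets is open. -/
def IsPSpace (X : Type u) [TopologicalSpace X] : Prop :=
  ∀ U : ℕ → Set X, (∀ n, IsOpen (U n)) → IsOpen (⋂ n, U n)

/-- Realcompactness: for no Tychonoff space `Y` containing `X` as a proper dense subspace is the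
restriction map `C(Y) → C(X)` onto. A Hausdorff space with a dense subset of the size of `X` has at
most `2 ^ 2 ^ |X|` points, so it is enough to let `Y` range over the universe of `X`. -/
def IsRealcompact (X : Type u) [TopologicalSpace X] : Prop :=
  ∀ (Y : Type u) [TopologicalSpace Y] [T35Space Y] (e : C(X, Y)),
    IsDenseEmbedding e → ¬ Function.Surjective e →
      ¬ Function.Surjective (fun f : C(Y, ℝ) => f.comp e)

section VectorLattice

variable {E : Type u} [AddCommGroup E] [Lattice E] [Module ℝ E]

/-- A linear functional is order bounded if it maps order intervals to bounded sets. -/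
def IsOrderBounded (φ : E →ₗ[ℝ] ℝ) : Prop :=
  ∀ a b : E, ∃ M : ℝ, ∀ u ∈ Set.Icc a b, |φ u| ≤ M

/-- `y n ↓ 0`. -/
def DecreasesToZero (y : ℕ → E) : Prop :=
  Antitone y ∧ IsGLB (Set.range y) 0

/-- The sequence `u` converges in order to `0`. -/
def OrderConvergesToZero (u : ℕ → E) : Prop :=
  ∃ y : ℕ → E, DecreasesToZero y ∧ ∀ n, |u n| ≤ y n

/-- A linear functional is σ-order continuous if it maps sequences converging in order to `0` to
null sequences. -/
def IsSigmaOrderContinuous (φ : E →ₗ[ℝ] ℝ) : Prop :=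
  ∀ u : ℕ → E, OrderConvergesToZero u →
    Filter.Tendsto (fun n => φ (u n)) Filter.atTop (nhds 0)

variable (E)

/-- The order dual of `E`: all order bounded linear functionals. -/
def orderBoundedDual : Submodule ℝ (E →ₗ[ℝ] ℝ) where
  carrier := {φ | IsOrderBounded φ}
  zero_mem' := fun _ _ => ⟨0, fun _ _ => by simp⟩
  add_mem' := by
    intro φ ψ hφ hψ a b
    obtain ⟨M, hM⟩ := hφ a b
    obtain ⟨N, hN⟩ := hψ a b
    exact ⟨M + N, fun u hu => (abs_add_le _ _).trans (add_le_add (hM u hu) (hN u hu))⟩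
  smul_mem' := by
    intro c φ hφ a b
    obtain ⟨M, hM⟩ := hφ a b
    refine ⟨|c| * M, fun u hu => ?_⟩
    rw [LinearMap.smul_apply, smul_eq_mul, abs_mul]
    exact mul_le_mul_of_nonneg_left (hM u hu) (abs_nonneg c)

/-- The σ-order continuous dual of `E`: all order bounded, σ-order continuous linear
functionals. -/
def sigmaOrderContinuousDual : Submodule ℝ (E →ₗ[ℝ] ℝ) where
  carrier := {φ | φ ∈ orderBoundedDual E ∧ IsSigmaOrderContinuous φ}
  zero_mem' := ⟨Submodule.zero_mem _, fun _ _ => by simp⟩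
  add_mem' := by
    rintro φ ψ ⟨hφ, hφ'⟩ ⟨hψ, hψ'⟩
    exact ⟨Submodule.add_mem _ hφ hψ, fun u hu => by simpa using (hφ' u hu).add (hψ' u hu)⟩
  smul_mem' := by
    rintro c φ ⟨hφ, hφ'⟩
    exact ⟨Submodule.smul_mem _ c hφ, fun u hu => by simpa using (hφ' u hu).const_mul c⟩

end VectorLattice

/-- The point evaluation `δ_x` on `C(X)`. -/
def pointEval {X : Type u} [TopologicalSpace X] (x : X) : C(X, ℝ) →ₗ[ℝ] ℝ where
  toFun f := f x
  map_add' _ _ := rfl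
  map_smul' _ _ := rfl

/-- The linear map sending a finitely supported function `a` on `X`, that is, an element of
`c₀₀(X)`, to the functional `∑ x, a x • δ_x` on `C(X)`. -/
noncomputable def c00ToDual (X : Type u) [TopologicalSpace X] :
    (X →₀ ℝ) →ₗ[ℝ] (C(X, ℝ) →ₗ[ℝ] ℝ) :=
  Finsupp.linearCombination ℝ pointEval

/-! On a P-space any function of countably many continuous functions is again continuous. So if the
`h n` have point-finite supports, rescaling those with `φ (h n) ≠ 0` to have value `n` under `φ`
keeps them all below one continuous function; order boundedness then forces `φ (h n) = 0` for almost
all `n` (`IsOrderBounded.eventually_eq_zero`). This is used twice. It makes the clopen null sets of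
`φ` closed under countable unions: if `φ ≠ 0` and each clopen set or its complement is null, then
every `f` is constant off a null set, these constants are a limit of point evaluations, and
realcompactness makes `φ` a multiple of some `δ_x`. And if `φ` were outside the span, repeated
splitting would give infinitely many disjoint clopen pieces on which `φ` is nonzero, which is
impossible. -/

open Filter Topology TopologicalSpace

/-! ### Continuity and clopen sets in P-spaces -/

section PSpace

variable {X : Type u} [TopologicalSpace X]

theorem IsPSpace.countableInterFilter_nhds (hP : IsPSpace X) (x : X) :
    CountableInterFilter (𝓝 x) := by
  refine ⟨fun S hS hmem => ?_⟩
  rcases S.eq_empty_or_nonempty with rfl | hne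
  · simp
  obtain ⟨s, rfl⟩ := hS.exists_eq_range hne
  refine mem_of_superset ((hP (fun n => interior (s n)) fun n => isOpen_interior).mem_nhds ?_) ?_
  · exact Set.mem_iInter.2 fun n => mem_interior_iff_mem_nhds.2 (hmem _ ⟨n, rfl⟩)
  · rw [Set.sInter_range]
    exact Set.iInter_mono fun n => interior_subset

/-- Continuous real functions on a P-space are locally constant. -/
theorem IsPSpace.eventually_eq (hP : IsPSpace X) (f : C(X, ℝ)) (x : X) :
    ∀ᶠ y in 𝓝 x, f y = f x := by
  have := hP.countableInterFilter_nhds x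
  have h : ∀ᶠ y in 𝓝 x, ∀ n : ℕ, dist (f y) (f x) < 1 / ((n : ℝ) + 1) :=
    eventually_countable_forall.2 fun n =>
      f.continuous.continuousAt.eventually (Metric.ball_mem_nhds _ Nat.one_div_pos_of_nat)
  filter_upwards [h] with y hy
  by_contra hne
  obtain ⟨n, hn⟩ := exists_nat_one_div_lt (dist_pos.2 hne)
  exact (hy n).not_gt hn

/-- On a P-space, any function that depends only on the values of countably many continuous real
functions is continuous. -/
theorem IsPSpace.continuous_of_factors (hP : IsPSpace X) {Z : Type*} [TopologicalSpace Z]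
    (f : ℕ → C(X, ℝ)) (G : (ℕ → ℝ) → Z) : Continuous fun x => G fun n => f n x := by
  refine continuous_iff_continuousAt.2 fun x => ?_
  have := hP.countableInterFilter_nhds x
  have h : ∀ᶠ y in 𝓝 x, ∀ n, f n y = f n x :=
    eventually_countable_forall.2 fun n => hP.eventually_eq (f n) x
  refine Tendsto.congr' ?_ tendsto_const_nhds
  filter_upwards [h] with y hy
  simp only [hy]

theorem IsPSpace.isClopen_setOf_factors (hP : IsPSpace X) (f : ℕ → C(X, ℝ))
    (p : (ℕ → ℝ) → Prop) : IsClopen {x | p fun n => f n x} := by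
  have h : ∀ q : (ℕ → ℝ) → Prop, IsOpen {x | q fun n => f n x} := fun q => by
    refine isOpen_iff_mem_nhds.2 fun x hx => ?_
    have := hP.countableInterFilter_nhds x
    have h : ∀ᶠ y in 𝓝 x, ∀ n, f n y = f n x :=
      eventually_countable_forall.2 fun n => hP.eventually_eq (f n) x
    filter_upwards [h] with y hy
    simpa only [Set.mem_ofPred_eq, hy] using hx
  exact ⟨isOpen_compl_iff.1 (h fun v => ¬ p v), h p⟩

theorem IsPSpace.isClopen_preimage (hP : IsPSpace X) (f : C(X, ℝ)) (s : Set ℝ) :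
    IsClopen (f ⁻¹' s) :=
  hP.isClopen_setOf_factors (fun _ => f) fun v => v 0 ∈ s

theorem IsPSpace.isClopen_iUnion (hP : IsPSpace X) {A : ℕ → Set X} (hA : ∀ n, IsClopen (A n)) :
    IsClopen (⋃ n, A n) := by
  refine ⟨isOpen_compl_iff.1 ?_, isOpen_iUnion fun n => (hA n).isOpen⟩
  rw [Set.compl_iUnion]
  exact hP _ fun n => (hA n).compl.isOpen

end PSpace

/-! ### Cutting functions down to clopen sets -/

section Restriction

variable {X : Type u} [TopologicalSpace X]

/-- Multiplication by the indicator function of a clopen set. -/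
noncomputable def clopenRestrict (A : Clopens X) : C(X, ℝ) →ₗ[ℝ] C(X, ℝ) where
  toFun f := ⟨(A : Set X).indicator f, f.continuous.indicator fun x hx => by
    simp [A.isClopen.frontier_eq] at hx⟩
  map_add' f g := by
    ext x
    exact congrFun (Set.indicator_add (A : Set X) f g) x
  map_smul' c f := by
    ext x
    exact congrFun (Set.indicator_const_smul (A : Set X) c f) x

theorem clopenRestrict_apply_mem {A : Clopens X} (f : C(X, ℝ)) {x : X} (hx : x ∈ A) :
    clopenRestrict A f x = f x :=
  Set.indicator_of_mem (s := (A : Set X)) hx f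

theorem clopenRestrict_apply_notMem {A : Clopens X} (f : C(X, ℝ)) {x : X} (hx : x ∉ A) :
    clopenRestrict A f x = 0 :=
  Set.indicator_of_notMem (s := (A : Set X)) hx f

theorem clopenRestrict_inf_add_sdiff (A B : Clopens X) :
    clopenRestrict (A ⊓ B) + clopenRestrict (A \ B) = clopenRestrict A := by
  ext f x
  change (↑(A ⊓ B) : Set X).indicator f x + (↑(A \ B) : Set X).indicator f x
    = (A : Set X).indicator f x
  by_cases hA : x ∈ (A : Set X) <;> by_cases hB : x ∈ (B : Set X) <;> simp [hA, hB]

theorem clopenRestrict_top : clopenRestrict (⊤ : Clopens X) = LinearMap.id := by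
  ext f x
  exact clopenRestrict_apply_mem f (Set.mem_univ x)

theorem IsOrderBounded.comp_clopenRestrict {φ : C(X, ℝ) →ₗ[ℝ] ℝ} (hφ : IsOrderBounded φ)
    (A : Clopens X) : IsOrderBounded (φ ∘ₗ clopenRestrict A) := by
  intro a b
  obtain ⟨M, hM⟩ := hφ (clopenRestrict A a) (clopenRestrict A b)
  exact ⟨M, fun u hu => hM _ ⟨fun x => Set.indicator_le_indicator (hu.1 x),
    fun x => Set.indicator_le_indicator (hu.2 x)⟩⟩

end Restriction

/-! ### Null sets of an order bounded functional -/

section Null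

variable {X : Type u} [TopologicalSpace X] {φ : C(X, ℝ) →ₗ[ℝ] ℝ}

/-- On a P-space, an order bounded functional vanishes on almost all terms of a sequence of
functions with point-finite supports. -/
theorem IsOrderBounded.eventually_eq_zero (hP : IsPSpace X) (hφ : IsOrderBounded φ)
    (h : ℕ → C(X, ℝ)) (hfin : ∀ x, {n | h n x ≠ 0}.Finite) : ∀ᶠ n in atTop, φ (h n) = 0 := by
  -- The factor gives `φ (k n) = n` whenever `φ (h n) ≠ 0`; otherwise division by zero makes `k n =
  -- 0`, which is harmless.
  let k : ℕ → C(X, ℝ) := fun n => ((n : ℝ) / φ (h n)) • h n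
  let g : C(X, ℝ) := ⟨_, hP.continuous_of_factors k fun v => ∑' n, |v n|⟩
  have hk : ∀ n x, |k n x| ≤ g x := fun n x => by
    have hsum : Summable fun m => |k m x| :=
      summable_of_hasFiniteSupport <| (hfin x).subset fun m hm hm' => hm <| by
        simp [k, hm']
    exact hsum.le_tsum n fun m _ => abs_nonneg _
  obtain ⟨M, hM⟩ := hφ (-g) g
  filter_upwards [eventually_gt_atTop ⌈M⌉₊] with n hn
  by_contra hne
  have h1 := hM (k n) ⟨fun x => (abs_le.1 (hk n x)).1, fun x => (abs_le.1 (hk n x)).2⟩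
  rw [map_smul, smul_eq_mul, div_mul_cancel₀ _ hne, Nat.abs_cast] at h1
  exact absurd (Nat.lt_of_ceil_lt hn) h1.not_gt

/-- The functional `φ` vanishes on all functions that are zero outside `A`. -/
def VanishesOn (φ : C(X, ℝ) →ₗ[ℝ] ℝ) (A : Set X) : Prop :=
  ∀ f : C(X, ℝ), (∀ x ∉ A, f x = 0) → φ f = 0

theorem VanishesOn.mono {A B : Set X} (hB : VanishesOn φ B) (h : A ⊆ B) : VanishesOn φ A :=
  fun f hf => hB f fun x hx => hf x fun hA => hx (h hA)

theorem vanishesOn_empty : VanishesOn φ ∅ := fun f hf => by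
  have : f = 0 := ContinuousMap.ext fun x => hf x (Set.notMem_empty x)
  rw [this, map_zero]

/-- Cutting `f` along `A` stays within continuous functions because `A` is clopen; the remainder
lives on `B`. -/
theorem VanishesOn.union {A B : Set X} (hA : VanishesOn φ A) (hcl : IsClopen A)
    (hB : VanishesOn φ B) : VanishesOn φ (A ∪ B) := by
  intro f hf
  let A' : Clopens X := ⟨A, hcl⟩
  have h1 : φ (clopenRestrict A' f) = 0 := hA _ fun x hx => clopenRestrict_apply_notMem f hx
  have h2 : φ (f - clopenRestrict A' f) = 0 := hB _ fun x hx => by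
    by_cases hxA : x ∈ A
    · exact sub_eq_zero.2 (clopenRestrict_apply_mem (A := A') f hxA).symm
    · have h3 := clopenRestrict_apply_notMem (A := A') f hxA
      simp [h3, hf x (by simp [hxA, hx])]
  rwa [map_sub, h1, sub_zero] at h2

theorem VanishesOn.iUnion (hP : IsPSpace X) (hφ : IsOrderBounded φ) {A : ℕ → Set X}
    (hcl : ∀ n, IsClopen (A n)) (hA : ∀ n, VanishesOn φ (A n)) : VanishesOn φ (⋃ n, A n) := by
  intro f hf
  have hcl' : ∀ n, IsClopen (⋃ k ∈ Finset.range n, A k) := fun n =>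
    isClopen_biUnion_finset fun k _ => hcl k
  have hA' : ∀ n, VanishesOn φ (⋃ k ∈ Finset.range n, A k) := fun n => by
    induction n with
    | zero => simpa using vanishesOn_empty
    | succ n ih =>
      rw [Finset.range_add_one, Finset.set_biUnion_insert]
      exact (hA n).union (hcl n) ih
  let B : ℕ → Clopens X := fun n => ⟨_, hcl' n⟩
  have hB : ∀ n, φ (clopenRestrict (B n) f) = 0 := fun n =>
    hA' n _ fun x hx => clopenRestrict_apply_notMem f hx
  -- Each point of the union lies in `B n` for all large `n`, so the remainders have point-finite
  -- supports.
  have hfin : ∀ x, {n | (f - clopenRestrict (B n) f) x ≠ 0}.Finite := fun x => by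
    by_cases hx : x ∈ ⋃ n, A n
    · obtain ⟨m, hm⟩ := Set.mem_iUnion.1 hx
      refine (Set.finite_Iic m).subset fun n hn => Set.mem_Iic.2 (not_lt.1 fun hmn => hn ?_)
      have hxB : x ∈ B n := Set.mem_biUnion (Finset.mem_coe.2 (Finset.mem_range.2 hmn)) hm
      exact sub_eq_zero.2 (clopenRestrict_apply_mem f hxB).symm
    · have hxB : ∀ n, x ∉ B n := fun n h =>
        hx (Set.iUnion₂_subset (fun k _ => Set.subset_iUnion A k) h)
      convert Set.finite_empty
      ext n
      simp [clopenRestrict_apply_notMem f (hxB n), hf x hx]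
  obtain ⟨n, hn⟩ := (hφ.eventually_eq_zero hP _ hfin).exists
  rwa [map_sub, hB, sub_zero] at hn

/-- The filter of all sets whose complement is contained in a clopen set on which `φ` vanishes. -/
noncomputable def conullFilter (hP : IsPSpace X) (hφ : IsOrderBounded φ) : Filter X :=
  Filter.ofCountableUnion {s | ∃ N, IsClopen N ∧ VanishesOn φ N ∧ s ⊆ N}
    (by
      intro S hS hmem
      rcases S.eq_empty_or_nonempty with rfl | hne
      · exact ⟨∅, isClopen_empty, vanishesOn_empty, by simp⟩
      obtain ⟨s, rfl⟩ := hS.exists_eq_range hne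
      choose N hcl hN hsub using fun n => hmem (s n) ⟨n, rfl⟩
      refine ⟨⋃ n, N n, hP.isClopen_iUnion hcl, .iUnion hP hφ hcl hN, ?_⟩
      rw [Set.sUnion_range]
      exact Set.iUnion_mono hsub)
    (fun t ⟨N, hcl, hN, hsub⟩ s hst => ⟨N, hcl, hN, hst.trans hsub⟩)

instance (hP : IsPSpace X) (hφ : IsOrderBounded φ) :
    CountableInterFilter (conullFilter hP hφ) :=
  Filter.countableInter_ofCountableUnion _ _ _

theorem mem_conullFilter {hP : IsPSpace X} {hφ : IsOrderBounded φ} {s : Set X} :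
    s ∈ conullFilter hP hφ ↔ ∃ N, IsClopen N ∧ VanishesOn φ N ∧ sᶜ ⊆ N :=
  Iff.rfl

theorem conullFilter_neBot (hP : IsPSpace X) (hφ : IsOrderBounded φ) (h0 : φ ≠ 0) :
    (conullFilter hP hφ).NeBot := by
  refine ⟨fun h => h0 ?_⟩
  obtain ⟨N, -, hN, hsub⟩ := mem_conullFilter.1 (empty_mem_iff_bot.2 h)
  ext f
  exact hN f fun x hx => absurd (hsub (Set.notMem_empty x)) hx

theorem map_eq_of_eventuallyEq_conullFilter {hP : IsPSpace X} {hφ : IsOrderBounded φ}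
    {f g : C(X, ℝ)} (h : ∀ᶠ x in conullFilter hP hφ, f x = g x) : φ f = φ g := by
  obtain ⟨N, -, hN, hsub⟩ := mem_conullFilter.1 h
  rw [← sub_eq_zero, ← map_sub]
  exact hN _ fun x hx => sub_eq_zero.2 (not_not.1 fun hne => hx (hsub hne))

end Null

/-! ### Realcompactness and limits of point evaluations -/

section Realcompact

variable {X : Type u} [TopologicalSpace X] [T35Space X]

theorem exists_continuousMap_separating (x : X) {K : Set X} (hK : IsClosed K) (hx : x ∉ K) :
    ∃ f : C(X, ℝ), 0 ≤ f ∧ f x = 1 ∧ ∀ y ∈ K, f y = 0 := by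
  obtain ⟨f, hf, hfx, hfK⟩ := CompletelyRegularSpace.completely_regular x K hK hx
  refine ⟨⟨fun y => 1 - (f y : ℝ), by fun_prop⟩, fun y => sub_nonneg.2 (f y).2.2, ?_, ?_⟩
  · simp [hfx]
  · intro y hy
    simp [hfK hy]

variable (X) in
theorem isEmbedding_eval : IsEmbedding fun (x : X) (f : C(X, ℝ)) => f x := by
  refine ⟨isInducing_iff_nhds.2 fun x => le_antisymm ?_ ?_, fun x y hxy => ?_⟩
  · exact (continuous_pi fun f : C(X, ℝ) => f.continuous).continuousAt.le_comap
  · intro U hU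
    obtain ⟨f, -, hfx, hfK⟩ := exists_continuousMap_separating x
      (isOpen_interior (s := U)).isClosed_compl (not_not.2 (mem_interior_iff_mem_nhds.2 hU))
    refine ⟨{v | v f ≠ 0}, (isOpen_ne.preimage (continuous_apply f)).mem_nhds ?_, fun y hy => ?_⟩
    · simp [hfx]
    · exact interior_subset (not_not.1 fun h => hy (hfK y h))
  · by_contra hne
    obtain ⟨f, -, hfx, hfK⟩ := exists_continuousMap_separating x (isClosed_singleton (x := y)) hne
    have := congrFun hxy f
    simp [hfx, hfK y rfl] at this

/-- In a realcompact space, a functional on `C(X)` that is a pointwise limit of point evaluations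
is a point evaluation. -/
theorem IsRealcompact.exists_eq_eval (hR : IsRealcompact X) {p : C(X, ℝ) → ℝ}
    (hp : p ∈ closure (Set.range fun (x : X) (f : C(X, ℝ)) => f x)) :
    ∃ x : X, ∀ f : C(X, ℝ), f x = p f := by
  by_contra! hcon
  let ev : X → C(X, ℝ) → ℝ := fun x f => f x
  -- If `p` is not an evaluation, `S` adds one point to a dense copy of `X`, and the `f`-th
  -- coordinate extends each `f` to `S`.
  let S : Set (C(X, ℝ) → ℝ) := insert p (Set.range ev)
  let e : C(X, S) := ⟨fun x => ⟨ev x, .inr ⟨x, rfl⟩⟩,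
    (isEmbedding_eval X).continuous.subtype_mk _⟩
  have hemb : IsEmbedding e := .of_comp e.continuous continuous_subtype_val (isEmbedding_eval X)
  refine hR S e ⟨⟨hemb.isInducing, fun y => ?_⟩, hemb.injective⟩ (fun hsurj => ?_) fun f => ?_
  · rw [closure_subtype]
    have hr : Subtype.val '' Set.range e = Set.range ev := by
      rw [← Set.range_comp]
      rfl
    rw [hr]
    rcases y with ⟨y, rfl | hy⟩
    · exact hp
    · exact subset_closure hy
  · obtain ⟨x, hx⟩ := hsurj ⟨p, .inl rfl⟩
    obtain ⟨f, hf⟩ := hcon x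
    exact hf (congrFun (congrArg Subtype.val hx) f)
  · exact ⟨⟨fun y => y.1 f, (continuous_apply f).comp continuous_subtype_val⟩, rfl⟩

end Realcompact

/-! ### The order dual and the span of the point evaluations -/

section OrderDual

variable {X : Type u} [TopologicalSpace X]

theorem isOrderBounded_pointEval (x : X) : IsOrderBounded (pointEval x) := fun a b =>
  ⟨max |a x| |b x|, fun _ hu => abs_le_max_abs_abs (hu.1 x) (hu.2 x)⟩

/-- If all `y n x ≥ ε`, then `ε` times the indicator of the clopen set where this holds is a nonzero
positive lower bound of the sequence. -/
theorem DecreasesToZero.tendsto_apply (hP : IsPSpace X) {y : ℕ → C(X, ℝ)}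
    (hy : DecreasesToZero y) (x : X) : Tendsto (fun n => y n x) atTop (𝓝 0) := by
  have h0 : ∀ n z, 0 ≤ y n z := fun n z => hy.2.1 ⟨n, rfl⟩ z
  have hanti : Antitone fun n => y n x := fun m n hmn => hy.1 hmn x
  refine Metric.tendsto_atTop.2 fun ε hε => ?_
  suffices h : ∃ n, y n x < ε by
    obtain ⟨N, hN⟩ := h
    refine ⟨N, fun n hn => ?_⟩
    rw [Real.dist_eq, sub_zero, abs_of_nonneg (h0 n x)]
    exact (hanti hn).trans_lt hN
  by_contra! hcon
  let V : Clopens X := ⟨_, hP.isClopen_setOf_factors y fun v => ∀ n, ε ≤ v n⟩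
  let g : C(X, ℝ) := clopenRestrict V (ContinuousMap.const X ε)
  have hg : g ≤ 0 := hy.2.2 <| by
    rintro _ ⟨n, rfl⟩ z
    by_cases hz : z ∈ V
    · exact (clopenRestrict_apply_mem _ hz).le.trans (hz n)
    · exact (clopenRestrict_apply_notMem _ hz).le.trans (h0 n z)
  have hxV : x ∈ V := hcon
  exact absurd ((clopenRestrict_apply_mem _ hxV).symm.le.trans (hg x)) hε.not_ge

theorem pointEval_mem_sigmaOrderContinuousDual (hP : IsPSpace X) (x : X) :
    pointEval x ∈ sigmaOrderContinuousDual C(X, ℝ) := by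
  refine ⟨isOrderBounded_pointEval x, fun u ⟨y, hy, huy⟩ => ?_⟩
  refine squeeze_zero_norm (fun n => ?_) (hy.tendsto_apply hP x)
  exact huy n x

theorem span_pointEval_le (hP : IsPSpace X) :
    Submodule.span ℝ (Set.range (pointEval (X := X))) ≤ sigmaOrderContinuousDual C(X, ℝ) :=
  Submodule.span_le.2 <| Set.range_subset_iff.2 (pointEval_mem_sigmaOrderContinuousDual hP)

variable {φ : C(X, ℝ) →ₗ[ℝ] ℝ}

/-- An order bounded functional whose null sets decide every clopen set is a multiple of a point
evaluation. -/
theorem mem_span_pointEval_of_forall_clopens [T35Space X] (hP : IsPSpace X) (hR : IsRealcompact X)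
    (hφ : IsOrderBounded φ)
    (h : ∀ B : Clopens X, VanishesOn φ B ∨ VanishesOn φ (B : Set X)ᶜ) :
    φ ∈ Submodule.span ℝ (Set.range (pointEval (X := X))) := by
  by_cases h0 : φ = 0
  · exact h0 ▸ Submodule.zero_mem _
  have := conullFilter_neBot hP hφ h0
  have hconst : ∀ f : C(X, ℝ), ∃ t : ℝ, f =ᶠ[conullFilter hP hφ] Function.const X t := fun f => by
    -- Countably many open sets separate the points of `ℝ`, and the filter is closed under countable
    -- intersections, so it is enough to decide each preimage.
    refine exists_eventuallyEq_const_of_forall_separating IsOpen fun U _ => ?_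
    have hU := hP.isClopen_preimage f U
    rcases h ⟨_, hU⟩ with hv | hv
    · exact .inr ⟨_, hU, hv, fun x hx => not_not.1 hx⟩
    · exact .inl ⟨_, hU.compl, hv, fun x hx => hx⟩
  choose p hp using hconst
  obtain ⟨x, hx⟩ := hR.exists_eq_eval (p := p) <|
    mem_closure_of_tendsto (f := fun (x : X) (f : C(X, ℝ)) => f x) (b := conullFilter hP hφ)
      (tendsto_pi_nhds.2 fun f => tendsto_const_nhds.congr' (hp f).symm)
      (Eventually.of_forall fun x => ⟨x, rfl⟩)
  have hφx : φ = φ 1 • pointEval x := by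
    ext f
    have h1 : φ f = φ (f x • (1 : C(X, ℝ))) :=
      map_eq_of_eventuallyEq_conullFilter (hP := hP) (hφ := hφ) <| (hp f).mono fun y hy => by
        simpa [hx f] using hy
    rw [h1, map_smul, smul_eq_mul, mul_comm]
    rfl
  rw [hφx]
  exact Submodule.smul_mem _ _ (Submodule.subset_span ⟨x, rfl⟩)

/-- Some clopen `B` is undecided, so it cuts `A` into two pieces on both of which `φ` is nonzero.
The two restrictions cannot both lie in the span; a piece outside it is kept. -/
theorem exists_le_comp_clopenRestrict_notMem_span [T35Space X] (hP : IsPSpace X)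
    (hR : IsRealcompact X) (hφ : IsOrderBounded φ) {A : Clopens X}
    (hA : φ ∘ₗ clopenRestrict A ∉ Submodule.span ℝ (Set.range (pointEval (X := X)))) :
    ∃ A' ≤ A, φ ∘ₗ clopenRestrict A' ∉ Submodule.span ℝ (Set.range (pointEval (X := X))) ∧
      φ ∘ₗ clopenRestrict (A \ A') ≠ 0 := by
  have hex : ∃ B : Clopens X, ¬ VanishesOn (φ ∘ₗ clopenRestrict A) B ∧
      ¬ VanishesOn (φ ∘ₗ clopenRestrict A) (B : Set X)ᶜ := by
    by_contra! hcon
    exact hA (mem_span_pointEval_of_forall_clopens hP hR (hφ.comp_clopenRestrict A)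
      fun B => or_iff_not_imp_left.2 (hcon B))
  obtain ⟨B, hB, hB'⟩ := hex
  have hne : φ ∘ₗ clopenRestrict (A ⊓ B) ≠ 0 := fun h => hB fun f hf => by
    rw [← clopenRestrict_inf_add_sdiff A B, LinearMap.comp_add, h, zero_add, LinearMap.comp_apply]
    have : clopenRestrict (A \ B) f = 0 := by
      ext x
      by_cases hx : x ∈ A \ B
      · exact (clopenRestrict_apply_mem f hx).trans (hf x hx.2)
      · exact clopenRestrict_apply_notMem f hx
    rw [this, map_zero]
  have hne' : φ ∘ₗ clopenRestrict (A \ B) ≠ 0 := fun h => hB' fun f hf => by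
    rw [← clopenRestrict_inf_add_sdiff A B, LinearMap.comp_add, h, add_zero, LinearMap.comp_apply]
    have : clopenRestrict (A ⊓ B) f = 0 := by
      ext x
      by_cases hx : x ∈ A ⊓ B
      · exact (clopenRestrict_apply_mem f hx).trans (hf x (not_not.2 hx.2))
      · exact clopenRestrict_apply_notMem f hx
    rw [this, map_zero]
  by_cases hmem : φ ∘ₗ clopenRestrict (A ⊓ B) ∈ Submodule.span ℝ (Set.range (pointEval (X := X)))
  · refine ⟨A \ B, sdiff_le, fun hmem' => hA ?_, by rwa [sdiff_sdiff_right_self]⟩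
    rw [← clopenRestrict_inf_add_sdiff A B, LinearMap.comp_add]
    exact Submodule.add_mem _ hmem hmem'
  · exact ⟨A ⊓ B, inf_le_left, hmem, by rwa [sdiff_inf_self_left]⟩

theorem IsOrderBounded.mem_span_pointEval [T35Space X] (hP : IsPSpace X) (hR : IsRealcompact X)
    (hφ : IsOrderBounded φ) : φ ∈ Submodule.span ℝ (Set.range (pointEval (X := X))) := by
  by_contra hcon
  let T := {A : Clopens X //
    φ ∘ₗ clopenRestrict A ∉ Submodule.span ℝ (Set.range (pointEval (X := X)))}
  have hstep : ∀ A : T, ∃ A' : T, A'.1 ≤ A.1 ∧ φ ∘ₗ clopenRestrict (A.1 \ A'.1) ≠ 0 := fun A =>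
    let ⟨A', hle, hA', hne⟩ := exists_le_comp_clopenRestrict_notMem_span hP hR hφ A.2
    ⟨⟨A', hA'⟩, hle, hne⟩
  choose next hle hne using hstep
  let A : ℕ → T := fun n => next^[n] ⟨⊤, by rwa [clopenRestrict_top, LinearMap.comp_id]⟩
  have hsucc : ∀ n, A (n + 1) = next (A n) := fun n => Function.iterate_succ_apply' next n _
  have hanti : Antitone fun n => (A n).1 := antitone_nat_of_succ_le fun n => by
    rw [hsucc]
    exact hle _
  have hf : ∀ n, ∃ f, φ (clopenRestrict ((A n).1 \ (A (n + 1)).1) f) ≠ 0 := fun n => by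
    by_contra! h
    refine hne (A n) (LinearMap.ext fun f => ?_)
    rw [← hsucc]
    exact h f
  choose f hf using hf
  have hfin : ∀ x, {n | clopenRestrict ((A n).1 \ (A (n + 1)).1) (f n) x ≠ 0}.Finite := fun x => by
    have hmem : ∀ n, clopenRestrict ((A n).1 \ (A (n + 1)).1) (f n) x ≠ 0 →
        x ∈ (A n).1 ∧ x ∉ (A (n + 1)).1 := fun n hn =>
      not_not.1 fun h => hn (clopenRestrict_apply_notMem (f n) h)
    have hlt : ∀ m n, x ∉ (A (m + 1)).1 → x ∈ (A n).1 → n ≤ m := fun m n hm hn =>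
      not_lt.1 fun hmn => hm (hanti hmn hn)
    -- The successive differences of a decreasing sequence are disjoint.
    refine Set.Subsingleton.finite fun m hm n hn => ?_
    exact le_antisymm (hlt n m (hmem n hn).2 (hmem m hm).1) (hlt m n (hmem m hm).2 (hmem n hn).1)
  obtain ⟨n, hn⟩ := (hφ.eventually_eq_zero hP _ hfin).exists
  exact hf n hn

end OrderDual

/-! ### The ordered space `c₀₀(X)` inside the dual -/

section FinitelySupported

variable {X : Type u} [TopologicalSpace X]

theorem c00ToDual_apply (a : X →₀ ℝ) (f : C(X, ℝ)) :
    c00ToDual X a f = a.sum fun x c => c * f x := by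
  simp [c00ToDual, Finsupp.linearCombination_apply, Finsupp.sum, LinearMap.sum_apply, pointEval]

theorem c00ToDual_nonneg_iff [T35Space X] (a : X →₀ ℝ) :
    (∀ f : C(X, ℝ), 0 ≤ f → 0 ≤ c00ToDual X a f) ↔ 0 ≤ a := by
  classical
  refine ⟨fun h x => ?_, fun h f hf => ?_⟩
  -- A test function that is `1` at `x` and `0` on the rest of the support reads off the coefficient
  -- `a x`.
  · obtain ⟨f, hf, hfx, hfK⟩ := exists_continuousMap_separating x
      (K := ↑(a.support.erase x)) (Finset.finite_toSet _).isClosed (by simp)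
    have h1 := h f hf
    rw [c00ToDual_apply, Finsupp.sum, Finset.sum_eq_single x, hfx, mul_one] at h1
    · exact h1
    · intro y hy hne
      rw [hfK y (by simpa [hne] using hy), mul_zero]
    · intro hx
      rw [Finsupp.notMem_support_iff.1 hx, zero_mul]
  · rw [c00ToDual_apply]
    exact Finset.sum_nonneg fun x _ => mul_nonneg (h x) (hf x)

theorem c00ToDual_le_iff [T35Space X] (a b : X →₀ ℝ) :
    (∀ f : C(X, ℝ), 0 ≤ f → c00ToDual X a f ≤ c00ToDual X b f) ↔ a ≤ b := by
  have h : a ≤ b ↔ 0 ≤ b - a := by simp [Finsupp.le_def]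
  rw [h, ← c00ToDual_nonneg_iff]
  simp only [map_sub, LinearMap.sub_apply, sub_nonneg]

theorem c00ToDual_injective [T35Space X] : Function.Injective (c00ToDual X) := fun a b hab =>
  le_antisymm ((c00ToDual_le_iff a b).1 fun f _ => by rw [hab])
    ((c00ToDual_le_iff b a).1 fun f _ => by rw [hab])

end FinitelySupported

theorem mainTheorem4 (X : Type u) [TopologicalSpace X] [T35Space X] (hP : IsPSpace X) :
    -- each point evaluation is σ-order continuous
    (∀ x : X, (pointEval x : C(X, ℝ) →ₗ[ℝ] ℝ) ∈ sigmaOrderContinuousDual C(X, ℝ)) ∧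
    (IsRealcompact X →
      orderBoundedDual C(X, ℝ) = Submodule.span ℝ (Set.range (pointEval (X := X))) ∧
      -- the span of the point evaluations is `c₀₀(X)`, as an ordered vector space
      (Function.Injective (c00ToDual X) ∧
        LinearMap.range (c00ToDual X) = Submodule.span ℝ (Set.range (pointEval (X := X))) ∧
        ∀ a b : X →₀ ℝ, (∀ f : C(X, ℝ), 0 ≤ f → c00ToDual X a f ≤ c00ToDual X b f) ↔ a ≤ b) ∧
      Submodule.span ℝ (Set.range (pointEval (X := X))) = sigmaOrderContinuousDual C(X, ℝ)) := by
  refine ⟨pointEval_mem_sigmaOrderContinuousDual hP, fun hR => ?_⟩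
  have hle : orderBoundedDual C(X, ℝ) ≤ Submodule.span ℝ (Set.range (pointEval (X := X))) :=
    fun φ hφ => IsOrderBounded.mem_span_pointEval hP hR hφ
  have hge := span_pointEval_le hP
  have hσ : sigmaOrderContinuousDual C(X, ℝ) ≤ orderBoundedDual C(X, ℝ) := fun φ hφ => hφ.1
  exact ⟨le_antisymm hle (hge.trans hσ),
    ⟨c00ToDual_injective, Finsupp.range_linearCombination ℝ, c00ToDual_le_iff⟩,
    le_antisymm hge (hσ.trans hle)⟩
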